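/- Let $n\ge 1$ and let $a\le b$ be integers with $a+b=0$ or $a+b=1$. Let $K_n^{ab}$ be the integral gain graph on the vertex set $[n]=\{1,\dots,n\}$ whose edges are all $g(i,j)$ with $1\le i<j\le n$ and $g$ an integer with $a\le g\le b$ (the edge joining $i$ and $j$ with gain $g$ in the direction from $i$ to $j$), and let $\mathcal A[K_n^{ab}]$ be the corresponding arrangement in $\mathbb R^n$, which consists of the hyperplanes $x_j-x_i=g$ for all these edges. For integers $\alpha,\beta\ge 0$, an $(\alpha,\beta)$-rooted labelled forest with $n$ vertices is a forest of rooted trees on the vertex set $[n]$ together with an integer weight on each edge, such that the weight of an edge with parent $i$ and child $j$ lies in $[1,\alpha]$ if $i<j$ and in $[1,\beta]$ if $i>j$ (an empty interval means that there are no such edges). Then the number of regions of $\mathcal A[K_n^{ab}]$ (that is, of connected components of the complement in $\mathbb R^n$ of the union of its hyperplanes) is finite and equals the number of $(1-a,b)$-rooted labelled forests with $n$ vertices. -/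

import Mathlib

/-- An integral gain graph on the vertex set `V`, given by its set of edges. An edge is recorded by
its endpoints and its gain: `HasEdge i j g` says that the edge `g(i,j)`, that is, the edge joining
`i` and `j` whose gain is `g` when it is oriented from `i` to `j`, is present. Reversing the
orientation negates the gain, so `g(i,j)` and `(-g)(j,i)` are the same edge. There are no loops;
several edges (with different gains) may join the same two vertices. -/
structure IntegralGainGraph (V : Type*) where
  HasEdge : V → V → ℤ → Prop
  orientable : ∀ i j g, HasEdge i j g → HasEdge j i (-g)
  loopless : ∀ i g, ¬ HasEdge i i g

/-- The gain graph `K_n^{ab}`: its edges are all `g(i,j)` with `i < j` and `a ≤ g ≤ b`. In the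
opposite orientation these are the edges with `j < i` and `a ≤ -g ≤ b`. The vertex set
`{1, …, n}` is modelled by `Fin n` with its usual order. -/
def intervalGainGraph (n : ℕ) (a b : ℤ) : IntegralGainGraph (Fin n) where
  HasEdge i j g := (i < j ∧ g ∈ Set.Icc a b) ∨ (j < i ∧ -g ∈ Set.Icc a b)
  orientable := by
    rintro i j g (⟨h, hg⟩ | ⟨h, hg⟩)
    · exact Or.inr ⟨h, by rwa [neg_neg]⟩
    · exact Or.inl ⟨h, hg⟩
  loopless := by
    rintro i g (⟨h, -⟩ | ⟨h, -⟩) <;> exact lt_irrefl i h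

/-- The affinographic hyperplane arrangement of a gain graph `Φ` on `n` vertices: the set of all
hyperplanes `x_j - x_i = g` in `ℝⁿ`, one for each edge `g(i,j)` of `Φ` with `i < j`. -/
def IntegralGainGraph.arrangement {n : ℕ} (Φ : IntegralGainGraph (Fin n)) :
    Set (Set (Fin n → ℝ)) :=
  {H | ∃ (i j : Fin n) (g : ℤ), i < j ∧ Φ.HasEdge i j g ∧ H = {x | x j - x i = (g : ℝ)}}

/-- The regions of an arrangement: the connected components of the complement of the union of its
members. -/
def arrangementRegions {n : ℕ} (A : Set (Set (Fin n → ℝ))) : Set (Set (Fin n → ℝ)) :=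
  {R | ∃ x ∈ (⋃₀ A)ᶜ, R = connectedComponentIn (⋃₀ A)ᶜ x}

/-- A rooted forest on the vertex set `V`, given by its parent relation: `parent j = some i` says
that `i` is the parent of `j`, and `parent j = none` that `j` is the root of its tree. There is
no infinite chain of successive ancestors; for finite `V` this says that there is no cycle, so
that every vertex is connected to exactly one root. -/
structure RootedForest (V : Type*) where
  parent : V → Option V
  wellFounded : WellFounded (fun i j : V => parent j = some i)

/-- The edges of a rooted forest, as pairs (parent, child). -/
def RootedForest.Edge {V : Type*} (F : RootedForest V) : Type _ :=
  {e : V × V // F.parent e.2 = some e.1}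

/-- An `(α,β)`-rooted labelled forest with `n` vertices: a rooted forest on `{1, …, n}` (modelled by
`Fin n`), each edge of which, with parent `i` and child `j`, carries an integer weight, which lies in
`[1,α]` if `i < j` and in `[1,β]` if `i > j`. These are the forests whose components are
`(α,β)`-rooted labelled trees. If `α = 0` or `β = 0` the interval in question is empty, so that there
are no such edges. -/
structure RootedLabelledForest (n : ℕ) (α β : ℤ) extends RootedForest (Fin n) where
  weight : toRootedForest.Edge → ℤ
  weight_mem_of_lt : ∀ e : toRootedForest.Edge, e.1.1 < e.1.2 → weight e ∈ Set.Icc 1 α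
  weight_mem_of_gt : ∀ e : toRootedForest.Edge, e.1.2 < e.1.1 → weight e ∈ Set.Icc 1 β

/-! Put `b = m`. The hyperplanes are `x u = x j + k` with `0 ≤ k ≤ m`, where offset `m` is present
for all pairs if `a = -m` (Catalan type) and only for `j < u` if `a = 1 - m` (Shi type); `Q` records
this.

A generic point gives a tree: the parent slot of `v` is the pair `(i, k)` for which `x i + k` is the
greatest such number below `x v`. There is one root and at most one child per slot, and the tree
determines all comparisons with offsets up to `m` (`EncodesOn.sameSide`). In the Shi case a region
leaves some comparisons with offset `m` open, so a canonical kind of point is needed. Every region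
has a generic compressed point (`exists_compressed`), and an inequality true there holds at every
point with the same recorded signs (`CompressedOn.lt_of_lt`); hence all compressed points of a
region yield the same tree. Compression means exactly that edges in slot `m` obey `Q`, and every
tree is realised (`exists_encodesOn`). So regions correspond to `slotMaps m Q P ∅`.

Forests allow siblings in the same slot, and weight minus one is the slot. To pass from trees to
forests, free the vertices one by one: `promote` turns the slot-`m` child of `v` into a sibling of
`v`, and `demote` undoes this (`ncard_slotMaps_insert`). Freeing the largest vertices first leaves
ascending edges in slot `m` (Catalan); freeing the smallest first leaves none (Shi). These are the
weight bounds `α = 1 - a` and `β = b`. -/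

/-- The hyperplane `x u = x j + k` belongs to the arrangement: `k ≤ m`, and for `k = m` the pair
`u, j` has to satisfy the relation `Q`. -/
def Sees {V : Type*} (m : ℕ) (Q : V → V → Prop) (u j : V) (k : ℕ) : Prop :=
  k ≤ m ∧ (k = m → Q u j)

/-- Two points lie on the same side of all the hyperplanes with indices in `s`. -/
def SameSideOn {V : Type*} (m : ℕ) (Q : V → V → Prop) (s : Finset V) (x y : V → ℝ) : Prop :=
  ∀ u ∈ s, ∀ j ∈ s, ∀ k : ℕ, Sees m Q u j k → (x j + k < x u ↔ y j + k < y u)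

/-- No two coordinates with indices in `s` differ by an integer of absolute value at most `m`. -/
def GenericOn {V : Type*} (m : ℕ) (s : Finset V) (x : V → ℝ) : Prop :=
  ∀ i ∈ s, ∀ j ∈ s, i ≠ j → ∀ k : ℕ, k ≤ m → x i + k ≠ x j

/-- Between `x i + m` and `x u`, where `x i + m < x u` is not recorded by the arrangement, there is
some `x j + k` whose position relative to `x u` is recorded. -/
def CompressedOn {V : Type*} (m : ℕ) (Q : V → V → Prop) (s : Finset V) (x : V → ℝ) : Prop :=
  ∀ u ∈ s, ∀ i ∈ s, ¬ Q u i → x i + m < x u →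
    ∃ j ∈ s, ∃ k : ℕ, Sees m Q u j k ∧ x i + m < x j + k ∧ x j + k < x u

/-- The map `t` assigns to every `v ∈ s` the pair `(i, k)` such that `x i + k` is the greatest
number of this form (with `k ≤ m`) below `x v`. -/
def EncodesOn {V : Type*} (m : ℕ) (t : V → Option (V × ℕ)) (s : Finset V) (x : V → ℝ) : Prop :=
  ∀ v ∈ s, (t v = none → ∀ j ∈ s, x v ≤ x j) ∧
    ∀ i k, t v = some (i, k) → i ∈ s ∧ k ≤ m ∧ x i + k < x v ∧
      ∀ j ∈ s, ∀ l : ℕ, l ≤ m → x j + l < x v → x j + l ≤ x i + k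

theorem exists_gap (Z : Finset ℝ) (p : ℝ) : ∃ y, p < y ∧ ∀ z ∈ Z, z ≤ p ∨ y < z := by
  induction Z using Finset.induction_on with
  | empty => exact ⟨p + 1, by linarith, by simp⟩
  | insert a Z _ ih =>
    obtain ⟨y, hy, h⟩ := ih
    by_cases ha : a ≤ p
    · exact ⟨y, hy, fun z hz => by
        rcases Finset.mem_insert.1 hz with rfl | hz
        exacts [Or.inl ha, h z hz]⟩
    · push Not at ha
      have h1 : p < min y a := lt_min hy ha
      refine ⟨(p + min y a) / 2, by linarith, fun z hz => ?_⟩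
      rcases Finset.mem_insert.1 hz with rfl | hz
      · right
        linarith [min_le_right y z]
      · refine (h z hz).imp_right fun h2 => ?_
        linarith [min_le_left y a]

/-! ### Compressed points of regions -/

section
variable {V : Type*} {m : ℕ} {Q : V → V → Prop} {s : Finset V} {x y : V → ℝ}

/-- A number slightly larger than `p`, such that `x j + k` for `|k| ≤ m` is either at most `p` or
beyond it. -/
theorem exists_gap_shifts (m : ℕ) (s : Finset V) (x : V → ℝ) (p : ℝ) :
    ∃ y, p < y ∧ (∀ j ∈ s, ∀ k : ℕ, k ≤ m → x j + k ≤ p ∨ y < x j + k) ∧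
      ∀ j ∈ s, ∀ k : ℕ, k ≤ m → x j - k ≤ p ∨ y < x j - k := by
  classical
  obtain ⟨y, hy, h⟩ := exists_gap
    ((s ×ˢ Finset.range (m + 1)).image (fun q => x q.1 + q.2) ∪
      (s ×ˢ Finset.range (m + 1)).image (fun q => x q.1 - q.2)) p
  refine ⟨y, hy, fun j hj k hk => h _ ?_, fun j hj k hk => h _ ?_⟩
  · exact Finset.mem_union_left _ (Finset.mem_image.2 ⟨(j, k), by simp [hj]; omega, rfl⟩)
  · exact Finset.mem_union_right _ (Finset.mem_image.2 ⟨(j, k), by simp [hj]; omega, rfl⟩)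

/-- Positive and negative shifts are both needed because the new coordinate may be either the larger
or the smaller member of a pair. -/
theorem GenericOn.update [DecidableEq V] (hx : GenericOn m s x) {v : V} (hv : v ∉ s) {p c : ℝ}
    (hp : p < c) (h1 : ∀ j ∈ s, ∀ k : ℕ, k ≤ m → x j + k ≤ p ∨ c < x j + k)
    (h2 : ∀ j ∈ s, ∀ k : ℕ, k ≤ m → x j - k ≤ p ∨ c < x j - k) :
    GenericOn m (insert v s) (Function.update x v c) := by
  have hne : ∀ j ∈ s, j ≠ v := fun j hj h => hv (h ▸ hj)
  intro i hi j hj hij k hk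
  rcases Finset.mem_insert.1 hi with rfl | his <;> rcases Finset.mem_insert.1 hj with rfl | hjs
  · exact absurd rfl hij
  · rw [Function.update_self, Function.update_of_ne (hne j hjs)]
    intro h
    rcases h2 j hjs k hk with h | h <;> linarith
  · rw [Function.update_self, Function.update_of_ne (hne i his)]
    intro h
    rcases h1 i his k hk with h | h <;> linarith
  · rw [Function.update_of_ne (hne i his), Function.update_of_ne (hne j hjs)]
    exact hx i his j hjs hij k hk

/-- Compressed points have as few unrecorded differences above `m` as their region permits. -/
theorem CompressedOn.lt_of_lt (hy : CompressedOn m Q s y) (h : SameSideOn m Q s x y) :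
    ∀ u ∈ s, ∀ i ∈ s, ∀ k : ℕ, k ≤ m → y i + k < y u → x i + k < x u := by
  classical
  suffices H : ∀ N : ℕ, ∀ u ∈ s, (s.filter (fun j => y j < y u)).card = N → ∀ i ∈ s,
      ∀ k : ℕ, k ≤ m → y i + k < y u → x i + k < x u from
    fun u hu => H _ u hu rfl
  intro N
  induction N using Nat.strong_induction_on with
  | _ N ih =>
    intro u hu hN i hi k hk hlt
    by_cases hs : Sees m Q u i k
    · exact (h u hu i hi k hs).2 hlt
    have hkm : k = m := by
      by_contra hne
      exact hs ⟨hk, fun h => absurd h hne⟩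
    subst hkm
    have hQ : ¬ Q u i := fun hq => hs ⟨le_rfl, fun _ => hq⟩
    obtain ⟨j, hj, l, hl, h1, h2⟩ := hy u hu i hi hQ hlt
    have h3 := (h u hu j hj l hl).2 h2
    -- Here `k` is the top offset. For `l = 0` the induction applies, as `y j < y u`; for `l > 0`
    -- the offset `k - l` is below the top one, so the comparison is recorded.
    suffices x i + k < x j + l by linarith
    rcases Nat.eq_zero_or_pos l with rfl | hl0
    · have hji : y j < y u := by simpa using h2
      have := ih _ (by
        rw [← hN]
        refine Finset.card_lt_card ⟨fun a ha => ?_, fun hsub => ?_⟩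
        · simp only [Finset.mem_filter] at ha ⊢
          exact ⟨ha.1, ha.2.trans hji⟩
        · have := hsub (Finset.mem_filter.2 ⟨hj, hji⟩)
          simp at this) j hj rfl i hi k le_rfl (by simpa using h1)
      simpa using this
    · have hc : ((k - l : ℕ) : ℝ) = (k : ℝ) - l := Nat.cast_sub hl.1
      have h4 := (h j hj i hi (k - l) ⟨Nat.sub_le _ _, fun h => by have := hl.1; omega⟩).2
        (by rw [hc]; linarith)
      rw [hc] at h4
      linarith

theorem SameSideOn.symm (h : SameSideOn m Q s x y) : SameSideOn m Q s y x :=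
  fun u hu j hj k hk => (h u hu j hj k hk).symm

/-- Every region contains a generic compressed point. -/
theorem exists_compressed (hQ : m = 0 → ∀ u j, Q u j) (s : Finset V) (x : V → ℝ)
    (hx : ∀ u ∈ s, ∀ j ∈ s, u ≠ j → ∀ k : ℕ, Sees m Q u j k → x j + k ≠ x u) :
    ∃ y, GenericOn m s y ∧ CompressedOn m Q s y ∧ SameSideOn m Q s x y := by
  classical
  have hzero : ∀ u j, Sees m Q u j 0 := fun u j => ⟨Nat.zero_le _, fun h => hQ h.symm u j⟩
  induction s using Finset.induction_on_max_value x with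
  | empty => exact ⟨x, by simp [GenericOn], by simp [CompressedOn], by simp [SameSideOn]⟩
  | insert v s hv hmax ih =>
    obtain ⟨y, hg, hc, hsame⟩ := ih fun u hu j hj =>
      hx u (Finset.mem_insert_of_mem hu) j (Finset.mem_insert_of_mem hj)
    have hne : ∀ j ∈ s, j ≠ v := fun j hj h => hv (h ▸ hj)
    have hlt : ∀ j ∈ s, x j < x v := fun j hj => (hmax j hj).lt_of_ne (by
      simpa using hx v (Finset.mem_insert_self _ _) j (Finset.mem_insert_of_mem hj)
        (hne j hj).symm 0 (hzero v j))
    rcases s.eq_empty_or_nonempty with rfl | ⟨j₀, hj₀⟩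
    · refine ⟨y, ?_, ?_, ?_⟩
      · intro i hi j hj hij
        simp only [insert_empty_eq, Finset.mem_singleton] at hi hj
        exact absurd (hi.trans hj.symm) hij
      · intro u hu i hi _ h
        simp only [insert_empty_eq, Finset.mem_singleton] at hu hi
        subst hu hi
        linarith [(Nat.cast_nonneg m : (0 : ℝ) ≤ m)]
      · intro u hu j hj k _
        simp only [insert_empty_eq, Finset.mem_singleton] at hu hj
        subst hu hj
        simp
    have hfull := hc.lt_of_lt hsame
    let A := (s ×ˢ Finset.range (m + 1)).filter fun q => Sees m Q v q.1 q.2 ∧ x q.1 + q.2 < x v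
    have hA : ∀ j k, (j, k) ∈ A ↔ j ∈ s ∧ Sees m Q v j k ∧ x j + k < x v := by
      intro j k
      simp only [A, Finset.mem_filter, Finset.mem_product, Finset.mem_range]
      constructor
      · rintro ⟨⟨h1, -⟩, h2⟩
        exact ⟨h1, h2⟩
      · rintro ⟨h1, h2⟩
        exact ⟨⟨h1, Nat.lt_succ_of_le h2.1.1⟩, h2⟩
    have hA0 : ∀ j ∈ s, (j, 0) ∈ A := fun j hj => (hA j 0).2 ⟨hj, hzero v j, by simpa using hlt j hj⟩
    -- The new coordinate goes just above the greatest recorded `y j + k` that `x` places below `x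
    -- v`: as low as the region permits.
    obtain ⟨⟨j₁, k₁⟩, hmem, hmax1⟩ := A.exists_max_image (fun q => y q.1 + q.2) ⟨_, hA0 j₀ hj₀⟩
    obtain ⟨hj₁, hs₁, hx₁⟩ := (hA _ _).1 hmem
    obtain ⟨c, hpc, hc1, hc2⟩ := exists_gap_shifts m s y (y j₁ + k₁)
    have hys : ∀ j ∈ s, y j < c := fun j hj => by
      have := hmax1 _ (hA0 j hj)
      simp only [Nat.cast_zero, add_zero] at this
      linarith
    have hbelow : ∀ j ∈ s, ∀ k, Sees m Q v j k → (x j + k < x v ↔ y j + k < c) := by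
      intro j hj k hk
      constructor
      · intro h
        have := hmax1 _ ((hA j k).2 ⟨hj, hk, h⟩)
        simp only at this
        linarith
      · intro h
        by_contra hnot
        have hle : y j + k ≤ y j₁ + k₁ := by
          rcases hc1 j hj k hk.1 with h' | h'
          exacts [h', absurd h (not_lt.2 h'.le)]
        -- If `x` and `y` order `j + k` and `j₁ + k₁` differently, compare `j` with `j₁` at the
        -- difference of the offsets. For `k ≤ k₁` this comparison is recorded; for `k > k₁` it may
        -- not be, and compression of `y` carries it over to `x`.
        rcases le_or_gt k k₁ with hkk | hkk
        · have hcast : ((k₁ - k : ℕ) : ℝ) = (k₁ : ℝ) - k := Nat.cast_sub hkk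
          have hsees : Sees m Q j j₁ (k₁ - k) := by
            refine ⟨(Nat.sub_le _ _).trans hs₁.1, fun hd => ?_⟩
            have : k = 0 := by
              have := hs₁.1
              have := hk.1
              by_contra h0
              omega
            subst this
            exact absurd (by simpa using hlt j hj) hnot
          have := (hsame j hj j₁ hj₁ _ hsees).1 (by rw [hcast]; linarith)
          rw [hcast] at this
          linarith
        · have hcast : ((k - k₁ : ℕ) : ℝ) = (k : ℝ) - k₁ := Nat.cast_sub hkk.le
          have hd : k - k₁ ≤ m := (Nat.sub_le _ _).trans hk.1
          by_cases hjj : j = j₁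
          · subst hjj
            have : (k₁ : ℝ) < k := by exact_mod_cast hkk
            linarith
          · have h1 := hg j hj j₁ hj₁ hjj _ hd
            have h2 := hfull j₁ hj₁ j hj _ hd
              (lt_of_le_of_ne (by rw [hcast]; linarith) h1)
            rw [hcast] at h2
            linarith
    have hup : ∀ j ∈ s, Function.update y v c j = y j := fun j hj =>
      Function.update_of_ne (hne j hj) _ _
    refine ⟨Function.update y v c, hg.update hv hpc hc1 hc2, ?_, ?_⟩
    · intro u hu i hi hq h
      rcases Finset.mem_insert.1 hi with rfl | his
      · exfalso
        rcases Finset.mem_insert.1 hu with rfl | hu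
        · linarith [(Nat.cast_nonneg m : (0 : ℝ) ≤ m)]
        · rw [Function.update_self, hup u hu] at h
          linarith [(Nat.cast_nonneg m : (0 : ℝ) ≤ m), hys u hu]
      rcases Finset.mem_insert.1 hu with rfl | hus
      · rw [Function.update_self, hup i his] at h
        refine ⟨j₁, Finset.mem_insert_of_mem hj₁, k₁, hs₁, ?_, ?_⟩
        · rw [hup i his, hup j₁ hj₁]
          have hle : y i + m ≤ y j₁ + k₁ := by
            rcases hc1 i his m le_rfl with h' | h'
            exacts [h', absurd h (not_lt.2 h'.le)]
          refine hle.lt_of_ne fun heq => ?_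
          by_cases hij : i = j₁
          · subst hij
            have : (m : ℝ) = k₁ := by linarith
            exact hq (hs₁.2 (by exact_mod_cast this.symm))
          · refine hg i his j₁ hj₁ hij (m - k₁) (Nat.sub_le _ _) ?_
            rw [Nat.cast_sub hs₁.1]
            linarith
        · rw [Function.update_self, hup j₁ hj₁]
          exact hpc
      · rw [hup i his, hup u hus] at h
        obtain ⟨j, hj, k, h1, h2, h3⟩ := hc u hus i his hq h
        refine ⟨j, Finset.mem_insert_of_mem hj, k, h1, ?_⟩
        rw [hup i his, hup u hus, hup j hj]
        exact ⟨h2, h3⟩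
    · intro u hu j hj k hk
      rcases Finset.mem_insert.1 hu with rfl | hus <;> rcases Finset.mem_insert.1 hj with rfl | hjs
      · simp
      · rw [Function.update_self, hup j hjs]
        exact hbelow j hjs k hk
      · rw [Function.update_self, hup u hus]
        have hk0 : (0 : ℝ) ≤ k := Nat.cast_nonneg k
        constructor <;> intro h
        · linarith [hlt u hus]
        · linarith [hys u hus]
      · rw [hup j hjs, hup u hus]
        exact hsame u hus j hjs k hk

/-! ### Generic points and slot trees -/

variable [Fintype V] {t t' : V → Option (V × ℕ)}

variable (m x) in
theorem exists_encodes : ∃ t, EncodesOn m t Finset.univ x := by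
  classical
  have key : ∀ v, ∃ o : Option (V × ℕ), (o = none → ∀ j, x v ≤ x j) ∧
      ∀ i k, o = some (i, k) → k ≤ m ∧ x i + k < x v ∧
        ∀ j, ∀ l : ℕ, l ≤ m → x j + l < x v → x j + l ≤ x i + k := by
    intro v
    let A := ((Finset.univ : Finset V) ×ˢ Finset.range (m + 1)).filter
      fun q => x q.1 + q.2 < x v
    have hA : ∀ j k, (j, k) ∈ A ↔ k ≤ m ∧ x j + k < x v := fun j k => by
      simp [A]
    rcases A.eq_empty_or_nonempty with h | h
    · refine ⟨none, fun _ j => ?_, by simp⟩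
      by_contra hj
      have : (j, 0) ∈ A := (hA j 0).2 ⟨Nat.zero_le _, by simpa using hj⟩
      simp [h] at this
    · obtain ⟨⟨i, k⟩, h1, h2⟩ := A.exists_max_image (fun q => x q.1 + q.2) h
      refine ⟨some (i, k), by simp, fun i' k' he => ?_⟩
      simp only [Option.some.injEq, Prod.mk.injEq] at he
      obtain ⟨rfl, rfl⟩ := he
      exact ⟨((hA _ _).1 h1).1, ((hA _ _).1 h1).2, fun j l hl hlt => h2 _ ((hA j l).2 ⟨hl, hlt⟩)⟩
  choose t ht using key
  exact ⟨t, fun v _ => ⟨fun h j _ => (ht v).1 h j, fun i k h =>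
    ⟨Finset.mem_univ _, ((ht v).2 i k h).1, ((ht v).2 i k h).2.1, fun j _ => ((ht v).2 i k h).2.2 j⟩⟩⟩

theorem EncodesOn.wellFounded (h : EncodesOn m t Finset.univ x) :
    WellFounded fun i j => ∃ k, t j = some (i, k) := by
  refine Subrelation.wf (r := fun i j => x i < x j) ?_ (Finite.wellFounded_of_trans_of_irrefl _)
  rintro i j ⟨k, hk⟩
  have := ((h j (Finset.mem_univ _)).2 i k hk).2.2.1
  show x i < x j
  linarith [(Nat.cast_nonneg k : (0 : ℝ) ≤ k)]

/-- If `u` lay below `v` in the same slot `(i, k)`, then `x u + 0` would be a greater candidate for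
`v` than `x i + k`. -/
theorem EncodesOn.injective (hx : GenericOn m Finset.univ x) (h : EncodesOn m t Finset.univ x) :
    Function.Injective t := by
  have key : ∀ u v, t u = t v → x v ≤ x u := by
    intro u v huv
    by_contra hlt
    push Not at hlt
    cases hv : t v with
    | none => exact absurd hlt (not_lt.2 ((h v (Finset.mem_univ _)).1 hv u (Finset.mem_univ _)))
    | some q =>
      obtain ⟨i, k⟩ := q
      have h1 := ((h v (Finset.mem_univ _)).2 i k hv).2.2.2 u (Finset.mem_univ _) 0
        (Nat.zero_le _) (by simpa using hlt)
      have h2 := ((h u (Finset.mem_univ _)).2 i k (huv.trans hv)).2.2.1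
      simp only [Nat.cast_zero, add_zero] at h1
      linarith
  intro u v huv
  by_contra hne
  exact hx u (Finset.mem_univ _) v (Finset.mem_univ _) hne 0 (Nat.zero_le _)
    (by simpa using le_antisymm (key v u huv.symm) (key u v huv))

/-- A violation of `Q` would, by compression, put some `x j + k` strictly between `x i + m` and `x
v`, against maximality. -/
theorem EncodesOn.rel_of_compressed (hc : CompressedOn m Q Finset.univ x) (h : EncodesOn m t Finset.univ x) {v i : V}
    (hv : t v = some (i, m)) : Q v i := by
  by_contra hq
  obtain ⟨-, -, h1, h2⟩ := (h v (Finset.mem_univ _)).2 i m hv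
  obtain ⟨j, hj, k, hk, h3, h4⟩ := hc v (Finset.mem_univ _) i (Finset.mem_univ _) hq h1
  exact absurd (h2 j hj k hk.1 h4) (not_le.2 h3)

theorem EncodesOn.compressed (hx : GenericOn m Finset.univ x) (h : EncodesOn m t Finset.univ x)
    (hq : ∀ v i, t v = some (i, m) → Q v i) : CompressedOn m Q Finset.univ x := by
  intro u hu i hi hn hlt
  cases hv : t u with
  | none =>
    have := (h u hu).1 hv i hi
    linarith [(Nat.cast_nonneg m : (0 : ℝ) ≤ m)]
  | some q =>
    obtain ⟨j, k⟩ := q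
    obtain ⟨-, hk, h1, h2⟩ := (h u hu).2 j k hv
    refine ⟨j, Finset.mem_univ _, k, ⟨hk, fun hkm => hq u j (hkm ▸ hv)⟩, ?_, h1⟩
    refine (h2 i hi m le_rfl hlt).lt_of_ne fun heq => ?_
    by_cases hij : i = j
    · subst hij
      have : (m : ℝ) = k := by linarith
      have : m = k := by exact_mod_cast this
      exact hn (hq u i (this ▸ hv))
    · refine hx i hi j (Finset.mem_univ _) hij (m - k) (Nat.sub_le _ _) ?_
      rw [Nat.cast_sub hk]
      linarith

/-- Maximality replaces `x u + g < x v` by `x u + g ≤ x i + k`, a comparison of `u` with the parent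
of `v`. This is the recursion behind `EncodesOn.sameSide`. -/
theorem EncodesOn.lt_iff (hx : GenericOn m Finset.univ x) (h : EncodesOn m t Finset.univ x)
    {u v i : V} {k g : ℕ} (hv : t v = some (i, k)) (hg : g ≤ m) :
    x u + g < x v ↔ if k ≤ g then (u = i ∧ g = k) ∨ x u + (g - k : ℕ) < x i
      else ¬ x i + (k - g : ℕ) < x u := by
  obtain ⟨-, hk, h1, h2⟩ := (h v (Finset.mem_univ _)).2 i k hv
  have h3 : x u + g < x v ↔ x u + g ≤ x i + k :=
    ⟨h2 u (Finset.mem_univ _) g hg, fun h => by linarith⟩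
  rw [h3]
  split_ifs with hkg
  · rw [Nat.cast_sub hkg]
    by_cases hui : u = i
    · subst hui
      simp only [true_and]
      constructor
      · intro h
        left
        have : (g : ℝ) ≤ k := by linarith
        exact le_antisymm (by exact_mod_cast this) hkg
      · rintro (rfl | h)
        · exact le_rfl
        · linarith
    · have := hx u (Finset.mem_univ _) i (Finset.mem_univ _) hui (g - k) ((Nat.sub_le _ _).trans hg)
      rw [Nat.cast_sub hkg] at this
      constructor
      · intro h
        exact Or.inr (lt_of_le_of_ne (by linarith) this)
      · rintro (⟨h, -⟩ | h)
        · exact absurd h hui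
        · linarith
  · push Not at hkg
    rw [Nat.cast_sub hkg.le, not_lt]
    constructor <;> intro h <;> linarith

/-- The encoding determines the positions of the coordinates relative to each other. -/
theorem EncodesOn.sameSide (hx : GenericOn m Finset.univ x) (hy : GenericOn m Finset.univ y)
    (h : EncodesOn m t Finset.univ x) (h' : EncodesOn m t Finset.univ y) (u v : V) (g : ℕ)
    (hg : g ≤ m) : x u + g < x v ↔ y u + g < y v := by
  classical
  -- The rank of a coordinate drops on passing to the parent, so the sum of the two ranks serves as
  -- the induction measure.
  let ρ : V → ℕ := fun v => (Finset.univ.filter fun j => x j < x v).card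
  have hρ : ∀ v i k, t v = some (i, k) → ρ i < ρ v := by
    intro v i k hv
    have := ((h v (Finset.mem_univ _)).2 i k hv).2.2.1
    have hlt : x i < x v := by linarith [(Nat.cast_nonneg k : (0 : ℝ) ≤ k)]
    refine Finset.card_lt_card ⟨fun a ha => ?_, fun hsub => ?_⟩
    · simp only [Finset.mem_filter] at ha ⊢
      exact ⟨ha.1, ha.2.trans hlt⟩
    · have := hsub (Finset.mem_filter.2 ⟨Finset.mem_univ i, hlt⟩)
      simp at this
  suffices H : ∀ N u v, ρ u + ρ v = N → ∀ g : ℕ, g ≤ m → (x u + g < x v ↔ y u + g < y v) from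
    H _ u v rfl g hg
  intro N
  induction N using Nat.strong_induction_on with
  | _ N ih =>
    intro u v hN g hg
    cases hv : t v with
    | none =>
      have h1 := (h v (Finset.mem_univ _)).1 hv u (Finset.mem_univ _)
      have h2 := (h' v (Finset.mem_univ _)).1 hv u (Finset.mem_univ _)
      have hg0 : (0 : ℝ) ≤ g := Nat.cast_nonneg g
      constructor <;> intro h <;> linarith
    | some q =>
      obtain ⟨i, k⟩ := q
      have hk := ((h v (Finset.mem_univ _)).2 i k hv).2.1
      have hi := hρ v i k hv
      rw [h.lt_iff hx hv hg, h'.lt_iff hy hv hg,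
        ih (ρ u + ρ i) (by omega) u i rfl _ ((Nat.sub_le _ _).trans hg),
        ih (ρ i + ρ u) (by omega) i u rfl _ ((Nat.sub_le _ _).trans hk)]

theorem EncodesOn.transfer (hx : GenericOn m Finset.univ x) (h : EncodesOn m t Finset.univ x)
    (hxy : ∀ u v, ∀ g : ℕ, g ≤ m → (x u + g < x v ↔ y u + g < y v)) :
    EncodesOn m t Finset.univ y := by
  have h0 : ∀ u v, x u < x v ↔ y u < y v := fun u v => by simpa using hxy u v 0 (Nat.zero_le _)
  intro v hv
  refine ⟨fun hn j hj => ?_, fun i k hik => ?_⟩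
  · rw [← not_lt, ← h0, not_lt]
    exact (h v hv).1 hn j hj
  · obtain ⟨h1, h2, h3, h4⟩ := (h v hv).2 i k hik
    refine ⟨h1, h2, (hxy i v k h2).1 h3, fun j hj l hl hlt => ?_⟩
    have h5 := h4 j hj l hl ((hxy j v l hl).2 hlt)
    by_contra hcon
    rcases le_or_gt l k with hlk | hlk
    · have hc : ((k - l : ℕ) : ℝ) = (k : ℝ) - l := Nat.cast_sub hlk
      have := (hxy i j (k - l) ((Nat.sub_le _ _).trans h2)).2 (by rw [hc]; linarith)
      rw [hc] at this
      linarith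
    · have hc : ((l - k : ℕ) : ℝ) = (l : ℝ) - k := Nat.cast_sub hlk.le
      have hji : j ≠ i := by
        rintro rfl
        have : (k : ℝ) < l := by exact_mod_cast hlk
        linarith
      have hd : l - k ≤ m := (Nat.sub_le _ _).trans hl
      have := (hxy j i _ hd).1
        (lt_of_le_of_ne (by rw [hc]; linarith) (hx j hj i h1 hji _ hd))
      rw [hc] at this
      linarith

theorem EncodesOn.unique (hx : GenericOn m Finset.univ x) (h : EncodesOn m t Finset.univ x)
    (h' : EncodesOn m t' Finset.univ x) : t = t' := by
  funext v
  cases hv : t v with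
  | none =>
    cases hv' : t' v with
    | none => rfl
    | some q =>
      obtain ⟨i, k⟩ := q
      have h1 := (h v (Finset.mem_univ _)).1 hv i (Finset.mem_univ _)
      have h2 := ((h' v (Finset.mem_univ _)).2 i k hv').2.2.1
      linarith [(Nat.cast_nonneg k : (0 : ℝ) ≤ k)]
  | some q =>
    obtain ⟨i, k⟩ := q
    obtain ⟨-, hk, h1, h2⟩ := (h v (Finset.mem_univ _)).2 i k hv
    cases hv' : t' v with
    | none =>
      have h1' := (h' v (Finset.mem_univ _)).1 hv' i (Finset.mem_univ _)
      linarith [(Nat.cast_nonneg k : (0 : ℝ) ≤ k)]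
    | some q' =>
      obtain ⟨i', k'⟩ := q'
      obtain ⟨-, hk', h1', h2'⟩ := (h' v (Finset.mem_univ _)).2 i' k' hv'
      have heq : x i + k = x i' + k' :=
        le_antisymm (h2' i (Finset.mem_univ _) k hk h1) (h2 i' (Finset.mem_univ _) k' hk' h1')
      by_cases hii : i = i'
      · subst hii
        have : (k : ℝ) = k' := by linarith
        rw [Nat.cast_injective this]
      · exfalso
        rcases le_or_gt k k' with hkk | hkk
        · refine hx i' (Finset.mem_univ _) i (Finset.mem_univ _) (Ne.symm hii) (k' - k)
            ((Nat.sub_le _ _).trans hk') ?_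
          rw [Nat.cast_sub hkk]
          linarith
        · refine hx i (Finset.mem_univ _) i' (Finset.mem_univ _) hii (k - k')
            ((Nat.sub_le _ _).trans hk) ?_
          rw [Nat.cast_sub hkk.le]
          linarith

/-- Every slot tree encodes some generic point. -/
theorem exists_encodesOn (ht : Function.Injective t)
    (hwf : WellFounded fun i j => ∃ k, t j = some (i, k))
    (hm : ∀ v i k, t v = some (i, k) → k ≤ m) :
    ∃ x, GenericOn m Finset.univ x ∧ EncodesOn m t Finset.univ x := by
  classical
  rcases isEmpty_or_nonempty V with hV | hV
  · exact ⟨0, fun i => (hV.false i).elim, fun i => (hV.false i).elim⟩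
  obtain ⟨r, -, hr⟩ := hwf.has_min Set.univ Set.univ_nonempty
  have hr : t r = none := by
    cases h : t r with
    | none => rfl
    | some q => exact absurd ⟨q.2, h⟩ (hr q.1 (Set.mem_univ _))
  -- Coordinates are placed in increasing order. The last clause keeps every pending slot of a
  -- placed vertex at or above all placed coordinates.
  let Good : Finset V → Prop := fun P => r ∈ P ∧ ∃ x : V → ℝ, GenericOn m P x ∧ EncodesOn m t P x ∧
    ∀ w, w ∉ P → ∀ i ∈ P, ∀ k, t w = some (i, k) → ∀ u ∈ P, x u ≤ x i + k
  have hstart : Good {r} := by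
    refine ⟨Finset.mem_singleton_self r, 0, ?_, ?_, ?_⟩
    · intro i hi j hj hij
      simp only [Finset.mem_singleton] at hi hj
      exact absurd (hi.trans hj.symm) hij
    · intro v hv
      rw [Finset.mem_singleton] at hv
      subst hv
      exact ⟨fun _ j _ => le_rfl, fun i k h => by simp [hr] at h⟩
    · intro w _ i _ k _ u _
      simp
  obtain ⟨P, hP, hPmax⟩ := (Finset.univ.filter Good).exists_max_image Finset.card
    ⟨_, Finset.mem_filter.2 ⟨Finset.mem_univ _, hstart⟩⟩
  obtain ⟨hrP, x, hg, he, hpend⟩ := (Finset.mem_filter.1 hP).2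
  by_cases hall : P = Finset.univ
  · subst hall
    exact ⟨x, hg, he⟩
  exfalso
  let W := Finset.univ.filter fun w => w ∉ P ∧ ∃ i ∈ P, ∃ k, t w = some (i, k)
  have hW : W.Nonempty := by
    obtain ⟨w, hw, hmin⟩ := hwf.has_min {w | w ∉ P} (by
      by_contra hne
      rw [Set.not_nonempty_iff_eq_empty, Set.eq_empty_iff_forall_notMem] at hne
      exact hall (Finset.eq_univ_iff_forall.2 fun w => not_not.1 (hne w)))
    refine ⟨w, Finset.mem_filter.2 ⟨Finset.mem_univ _, hw, ?_⟩⟩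
    cases h : t w with
    -- By injectivity `r` is the only root.
    | none => exact absurd (ht (h.trans hr.symm) ▸ hrP) hw
    | some q => exact ⟨q.1, not_not.1 fun hq => hmin q.1 hq ⟨q.2, h⟩, q.2, rfl⟩
  -- The pending vertex with the lowest slot comes next, just above its slot.
  obtain ⟨v, hvW, hvmin⟩ := W.exists_min_image
    (fun w => (t w).elim 0 fun q => x q.1 + q.2) hW
  obtain ⟨-, hvP, i, hi, k, hik⟩ := Finset.mem_filter.1 hvW
  obtain ⟨c, hpc, hc1, hc2⟩ := exists_gap_shifts m P x (x i + k)
  have hne : ∀ j ∈ P, j ≠ v := fun j hj h => hvP (h ▸ hj)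
  have hup : ∀ j ∈ P, Function.update x v c j = x j := fun j hj =>
    Function.update_of_ne (hne j hj) _ _
  have hbelow : ∀ j ∈ P, x j < c := fun j hj => (hpend v hvP i hi k hik j hj).trans_lt hpc
  have hgood : Good (insert v P) := by
    refine ⟨Finset.mem_insert_of_mem hrP, Function.update x v c, hg.update hvP hpc hc1 hc2, ?_, ?_⟩
    · intro u hu
      rcases Finset.mem_insert.1 hu with rfl | huP
      · refine ⟨fun h => (by simp [hik] at h), fun i' k' h => ?_⟩
        simp only [hik, Option.some.injEq, Prod.mk.injEq] at h
        obtain ⟨rfl, rfl⟩ := h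
        rw [hup i hi, Function.update_self]
        refine ⟨Finset.mem_insert_of_mem hi, hm _ _ _ hik, hpc, fun j hj l hl hlt => ?_⟩
        rcases Finset.mem_insert.1 hj with rfl | hjP
        · rw [Function.update_self] at hlt
          linarith [(Nat.cast_nonneg l : (0 : ℝ) ≤ l)]
        · rw [hup j hjP] at hlt ⊢
          rcases hc1 j hjP l hl with h | h
          exacts [h, absurd hlt (not_lt.2 h.le)]
      · rw [hup u huP]
        refine ⟨fun h j hj => ?_, fun i' k' h => ?_⟩
        · rcases Finset.mem_insert.1 hj with rfl | hjP
          · rw [Function.update_self]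
            exact (hbelow u huP).le
          · rw [hup j hjP]
            exact (he u huP).1 h j hjP
        · obtain ⟨h1, h2, h3, h4⟩ := (he u huP).2 i' k' h
          rw [hup i' h1]
          refine ⟨Finset.mem_insert_of_mem h1, h2, h3, fun j hj l hl hlt => ?_⟩
          rcases Finset.mem_insert.1 hj with rfl | hjP
          · rw [Function.update_self] at hlt
            linarith [(Nat.cast_nonneg l : (0 : ℝ) ≤ l), hbelow u huP]
          · rw [hup j hjP] at hlt ⊢
            exact h4 j hjP l hl hlt
    · intro w hw i' hi' k' h u hu
      have hwP : w ∉ P := fun h => hw (Finset.mem_insert_of_mem h)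
      have hwv : w ≠ v := fun h => hw (h ▸ Finset.mem_insert_self _ _)
      have hk0 : (0 : ℝ) ≤ k' := Nat.cast_nonneg k'
      rcases Finset.mem_insert.1 hi' with rfl | hiP
      · rw [Function.update_self]
        rcases Finset.mem_insert.1 hu with rfl | huP
        · rw [Function.update_self]
          linarith
        · rw [hup u huP]
          linarith [hbelow u huP]
      · rw [hup i' hiP]
        rcases Finset.mem_insert.1 hu with rfl | huP
        · rw [Function.update_self]
          rcases hc1 i' hiP k' (hm _ _ _ h) with hle | hlt
          -- The slot of `w` would have the same value as that of `v`; genericity makes the slots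
          -- equal, and injectivity then gives `w = v`.
          · exfalso
            have hge := hvmin w (Finset.mem_filter.2 ⟨Finset.mem_univ _, hwP, i', hiP, k', h⟩)
            simp only [hik, h, Option.elim_some] at hge
            have heq : x i + k = x i' + k' := le_antisymm hge hle
            by_cases hii : i = i'
            · subst hii
              have hkk : (k : ℝ) = k' := by linarith
              rw [← Nat.cast_injective hkk] at h
              exact hwv (ht (h.trans hik.symm))
            · rcases le_or_gt k k' with hkk | hkk
              · refine hg i' hiP i hi (Ne.symm hii) (k' - k)
                  ((Nat.sub_le _ _).trans (hm _ _ _ h)) ?_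
                rw [Nat.cast_sub hkk]
                linarith
              · refine hg i hi i' hiP hii (k - k') ((Nat.sub_le _ _).trans (hm _ _ _ hik)) ?_
                rw [Nat.cast_sub hkk.le]
                linarith
          · exact hlt.le
        · rw [hup u huP]
          exact hpend w hwP i' hiP k' h u huP
  have hcard := hPmax _ (Finset.mem_filter.2 ⟨Finset.mem_univ _, hgood⟩)
  rw [Finset.card_insert_of_notMem hvP] at hcard
  omega

end

/-! ### From slot trees to forests -/

/-- Parent maps `g` with slots `0, …, m`, interpolating between trees with at most one child in
each slot and forests. The vertices outside `U` are alone in their slots, and their parents in slot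
`m` lie outside `U` and obey `Q`; the vertices in `U` may share slots, and their parents in slot `m`
obey `P`. -/
def slotMaps {V : Type*} (m : ℕ) (Q P : V → V → Prop) (U : Set V) : Set (V → Option (V × ℕ)) :=
  {g | (WellFounded fun i j => ∃ k, g j = some (i, k)) ∧ (∀ v i k, g v = some (i, k) → k ≤ m) ∧
    (∀ u v, u ∉ U → v ∉ U → g u = g v → u = v) ∧
    (∀ u i, u ∉ U → g u = some (i, m) → i ∉ U ∧ Q u i) ∧
    ∀ u i, u ∈ U → g u = some (i, m) → P u i}

open Classical in
/-- The child of `v` in slot `m` outside `U` becomes a sibling of `v`. -/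
noncomputable def promote {V : Type*} (m : ℕ) (U : Set V) (v : V) (g : V → Option (V × ℕ)) :
    V → Option (V × ℕ) :=
  fun c => if c ∉ U ∧ c ≠ v ∧ g c = some (v, m) then g v else g c

open Classical in
/-- The siblings of `v` outside `U` become children of `v` in slot `m`. -/
noncomputable def demote {V : Type*} (m : ℕ) (U : Set V) (v : V) (g : V → Option (V × ℕ)) :
    V → Option (V × ℕ) :=
  fun c => if c ∉ U ∧ c ≠ v ∧ g c = g v then some (v, m) else g c

section
variable {V : Type*} {m : ℕ} {Q P : V → V → Prop} {U : Set V} {v : V} {g : V → Option (V × ℕ)}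

theorem parent_ne (h : WellFounded fun i j => ∃ k, g j = some (i, k)) (v : V) (k : ℕ) :
    g v ≠ some (v, k) := by
  intro hk
  obtain ⟨w, hw, hmin⟩ := h.has_min {v} ⟨v, rfl⟩
  rw [Set.mem_singleton_iff] at hw
  subst hw
  exact hmin _ rfl ⟨k, hk⟩

theorem promote_self : promote m U v g v = g v := by simp [promote]

theorem demote_self : demote m U v g v = g v := by simp [demote]

theorem promote_mem (hv : v ∉ U) (hQ : ∀ u i j, Q u i → Q i j → Q u j)
    (hP : ∀ i, i ∉ U → i ≠ v → Q v i → P v i) (hg : g ∈ slotMaps m Q P U) :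
    promote m U v g ∈ slotMaps m Q P (insert v U) := by
  obtain ⟨hwf, hm, hinj, hq, hp⟩ := hg
  refine ⟨?_, ?_, ?_, ?_, ?_⟩
  -- A promoted vertex is attached to its former grandparent, so new edges are composites of old
  -- ones.
  · refine Subrelation.wf (r := Relation.TransGen fun i j => ∃ k, g j = some (i, k)) ?_ hwf.transGen
    rintro i j ⟨k, hk⟩
    unfold promote at hk
    split_ifs at hk with h
    · exact (Relation.TransGen.single ⟨k, hk⟩).tail ⟨m, h.2.2⟩
    · exact .single ⟨k, hk⟩
  · intro u i k hk
    unfold promote at hk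
    split_ifs at hk with h
    exacts [hm _ _ _ hk, hm _ _ _ hk]
  · intro u w hu hw huw
    simp only [Set.mem_insert_iff, not_or] at hu hw
    unfold promote at huw
    split_ifs at huw with h1 h2 h2
    · exact hinj u w hu.2 hw.2 (h1.2.2.trans h2.2.2.symm)
    · exact absurd (hinj v w hv hw.2 huw).symm hw.1
    · exact absurd (hinj u v hu.2 hv huw) hu.1
    · exact hinj u w hu.2 hw.2 huw
  · intro u i hu hi
    simp only [Set.mem_insert_iff, not_or] at hu ⊢
    unfold promote at hi
    split_ifs at hi with h
    · have h1 := hq v i hv hi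
      exact ⟨⟨fun hiv => parent_ne hwf v m (hiv ▸ hi), h1.1⟩,
        hQ _ _ _ (hq u v hu.2 h.2.2).2 h1.2⟩
    · have h1 := hq u i hu.2 hi
      exact ⟨⟨fun hiv => h ⟨hu.2, hu.1, hiv ▸ hi⟩, h1.1⟩, h1.2⟩
  · intro u i hu hi
    rcases hu with rfl | hu
    · rw [promote_self] at hi
      have h1 := hq u i hv hi
      exact hP i h1.1 (fun hiv => parent_ne hwf u m (hiv ▸ hi)) h1.2
    · unfold promote at hi
      rw [if_neg fun h => h.1 hu] at hi
      exact hp u i hu hi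

/-- `hPQ` restores the constraint on `v` as it rejoins the vertices outside `U`; `hQv` lets its
former siblings hang below it in slot `m`. -/
theorem demote_mem (hv : v ∉ U) (hPQ : ∀ i, P v i → i ∉ U ∧ Q v i)
    (hQv : ∀ c, c ∉ U → c ≠ v → Q c v) (hg : g ∈ slotMaps m Q P (insert v U)) :
    demote m U v g ∈ slotMaps m Q P U := by
  obtain ⟨hwf, hm, hinj, hq, hp⟩ := hg
  have hins : ∀ u, u ∉ U → u ≠ v → u ∉ insert v U := fun u hu huv => by simp [hu, huv]
  refine ⟨⟨fun x => ?_⟩, ?_, ?_, ?_, ?_⟩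
  · refine hwf.induction (C := Acc fun i j => ∃ k, demote m U v g j = some (i, k)) x fun x ih => ?_
    by_cases hx : x ∉ U ∧ x ≠ v ∧ g x = g v
    · refine ⟨x, fun i ⟨k, hk⟩ => ?_⟩
      rw [demote, if_pos hx] at hk
      simp only [Option.some.injEq, Prod.mk.injEq] at hk
      obtain ⟨rfl, rfl⟩ := hk
      -- The new grandparent of `x` is its old parent, since `v` keeps the slot that both shared.
      refine ⟨_, fun j ⟨l, hl⟩ => ih j ⟨l, ?_⟩⟩
      rw [demote_self] at hl
      exact hx.2.2.trans hl
    · refine ⟨x, fun i ⟨k, hk⟩ => ih i ⟨k, ?_⟩⟩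
      rwa [demote, if_neg hx] at hk
  · intro u i k hk
    unfold demote at hk
    split_ifs at hk with h
    · simp only [Option.some.injEq, Prod.mk.injEq] at hk
      exact hk.2.symm.le
    · exact hm _ _ _ hk
  · intro u w hu hw huw
    -- Slot `m` of `v` receives a demoted sibling. No vertex outside `U` was there before, because
    -- slot-`m` parents of such vertices avoid `insert v U`.
    have key : ∀ u w, u ∉ U → u ≠ v → g u = g v → w ∉ U → ¬(w ∉ U ∧ w ≠ v ∧ g w = g v) →
        some (v, m) = g w → False := by
      intro u w hu huv _ hw _ h
      by_cases hwv : w = v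
      · subst hwv
        exact parent_ne hwf w m h.symm
      · exact (hq w v (hins w hw hwv) h.symm).1 (Set.mem_insert _ _)
    unfold demote at huw
    split_ifs at huw with h1 h2 h2
    · exact hinj u w (hins u hu h1.2.1) (hins w hw h2.2.1) (h1.2.2.trans h2.2.2.symm)
    · exact (key u w hu h1.2.1 h1.2.2 hw h2 huw).elim
    · exact (key w u hw h2.2.1 h2.2.2 hu h1 huw.symm).elim
    · by_cases huv : u = v
      · subst huv
        by_contra hne
        exact h2 ⟨hw, Ne.symm hne, huw.symm⟩
      · by_cases hwv : w = v
        · subst hwv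
          exact absurd ⟨hu, huv, huw⟩ h1
        · exact hinj u w (hins u hu huv) (hins w hw hwv) huw
  · intro u i hu hi
    unfold demote at hi
    split_ifs at hi with h
    · simp only [Option.some.injEq, Prod.mk.injEq, and_true] at hi
      subst hi
      exact ⟨hv, hQv u hu h.2.1⟩
    · by_cases huv : u = v
      · subst huv
        exact hPQ i (hp u i (Set.mem_insert _ _) hi)
      · have h1 := hq u i (hins u hu huv) hi
        exact ⟨fun hiU => h1.1 (Set.mem_insert_of_mem _ hiU), h1.2⟩
  · intro u i hu hi
    unfold demote at hi
    rw [if_neg fun h => h.1 hu] at hi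
    exact hp u i (Set.mem_insert_of_mem _ hu) hi

theorem demote_promote (hv : v ∉ U) (hg : g ∈ slotMaps m Q P U) :
    demote m U v (promote m U v g) = g := by
  obtain ⟨-, -, hinj, -, -⟩ := hg
  funext c
  unfold demote
  rw [promote_self]
  by_cases h : c ∉ U ∧ c ≠ v ∧ g c = some (v, m)
  · have h1 : promote m U v g c = g v := if_pos h
    rw [if_pos ⟨h.1, h.2.1, h1⟩, h.2.2]
  · have h1 : promote m U v g c = g c := if_neg h
    rw [h1, if_neg fun h2 => h2.2.1 (hinj c v h2.1 hv h2.2.2)]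

theorem promote_demote (hg : g ∈ slotMaps m Q P (insert v U)) :
    promote m U v (demote m U v g) = g := by
  obtain ⟨-, -, -, hq, -⟩ := hg
  funext c
  unfold promote
  rw [demote_self]
  by_cases h : c ∉ U ∧ c ≠ v ∧ g c = g v
  · have h1 : demote m U v g c = some (v, m) := if_pos h
    rw [if_pos ⟨h.1, h.2.1, h1⟩, h.2.2]
  · have h1 : demote m U v g c = g c := if_neg h
    rw [h1, if_neg fun h2 => ?_]
    exact (hq c v (by simp [h2.1, h2.2.1]) h2.2.2).1 (Set.mem_insert _ _)

theorem ncard_slotMaps_insert (hv : v ∉ U) (hQ : ∀ u i j, Q u i → Q i j → Q u j)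
    (hP : ∀ i, i ∉ U → i ≠ v → Q v i → P v i) (hPQ : ∀ i, P v i → i ∉ U ∧ Q v i)
    (hQv : ∀ c, c ∉ U → c ≠ v → Q c v) :
    (slotMaps m Q P (insert v U)).ncard = (slotMaps m Q P U).ncard := by
  refine (Set.ncard_congr (fun g _ => promote m U v g) (fun g hg => promote_mem hv hQ hP hg)
    (fun g g' hg hg' h => ?_) fun g hg =>
      ⟨demote m U v g, demote_mem hv hPQ hQv hg, promote_demote hg⟩).symm
  rw [← demote_promote hv hg, h, demote_promote hv hg']

theorem finite_slotMaps [Finite V] : (slotMaps m Q P U).Finite := by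
  refine Set.Finite.subset (Set.Finite.pi' (t := fun _ : V =>
    insert none (some '' (Set.univ ×ˢ Set.Iic m))) fun _ =>
      ((Set.finite_univ.prod (Set.finite_Iic m)).image _).insert _) ?_
  intro g hg v
  cases h : g v with
  | none => exact Set.mem_insert _ _
  | some q => exact Set.mem_insert_of_mem _ ⟨q, ⟨trivial, hg.2.1 v q.1 q.2 h⟩, rfl⟩

end

/-! ### The Catalan and Shi orders of freeing vertices -/

/-- Slot trees without further restrictions are as numerous as forests whose edges in slot `m`
ascend. -/
theorem ncard_slotMaps_catalan (n m : ℕ) :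
    (slotMaps (V := Fin n) m (fun _ _ => True) (fun v i => i < v) Set.univ).ncard =
      (slotMaps (V := Fin n) m (fun _ _ => True) (fun v i => i < v) ∅).ncard := by
  have key : ∀ r : ℕ, r ≤ n →
      (slotMaps (V := Fin n) m (fun _ _ => True) (fun v i => i < v) {u | n - r ≤ u.1}).ncard =
      (slotMaps (V := Fin n) m (fun _ _ => True) (fun v i => i < v) ∅).ncard := by
    intro r
    induction r with
    | zero =>
      intro _
      congr 2
      ext u
      simp
    | succ r ih =>
      intro hr
      rw [← ih (by omega)]
      -- The vertex being freed is the largest outside `U`, so a slot-`m` parent outside `U` is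
      -- automatically smaller.
      have hs : {u : Fin n | n - (r + 1) ≤ u.1} =
          insert ⟨n - (r + 1), by omega⟩ {u : Fin n | n - r ≤ u.1} := by
        ext u
        simp only [Set.mem_ofPred_eq, Set.mem_insert_iff, Fin.ext_iff]
        omega
      rw [hs]
      refine ncard_slotMaps_insert ?_ ?_ ?_ ?_ ?_
      · simp only [Set.mem_ofPred_eq]
        omega
      · simp
      · intro i h1 h2 _
        simp only [Set.mem_ofPred_eq, Fin.lt_def, ne_eq, Fin.ext_iff] at *
        omega
      · refine fun i h1 => ⟨fun h2 => ?_, trivial⟩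
        simp only [Set.mem_ofPred_eq, Fin.lt_def] at *
        omega
      · simp
  rw [← key n le_rfl]
  congr 2
  ext u
  simp

/-- Slot trees whose edges in slot `m` ascend are as numerous as forests without edges in
slot `m`. -/
theorem ncard_slotMaps_shi (n m : ℕ) :
    (slotMaps (V := Fin n) m (fun v i => i < v) (fun _ _ => False) Set.univ).ncard =
      (slotMaps (V := Fin n) m (fun v i => i < v) (fun _ _ => False) ∅).ncard := by
  have key : ∀ r : ℕ, r ≤ n →
      (slotMaps (V := Fin n) m (fun v i => i < v) (fun _ _ => False) {u | u.1 < r}).ncard =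
      (slotMaps (V := Fin n) m (fun v i => i < v) (fun _ _ => False) ∅).ncard := by
    intro r
    induction r with
    | zero =>
      intro _
      congr 2
      ext u
      simp
    | succ r ih =>
      intro hr
      rw [← ih (by omega)]
      -- The vertex being freed is the smallest outside `U`: all others there may hang below it in
      -- slot `m`, and it has no admissible slot-`m` parent.
      have hs : {u : Fin n | u.1 < r + 1} = insert ⟨r, by omega⟩ {u : Fin n | u.1 < r} := by
        ext u
        simp only [Set.mem_ofPred_eq, Set.mem_insert_iff, Fin.ext_iff]
        omega
      rw [hs]
      refine ncard_slotMaps_insert ?_ ?_ ?_ ?_ ?_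
      · simp
      · exact fun u i j h1 h2 => h2.trans h1
      · intro i h1 h2 h3
        simp only [Set.mem_ofPred_eq, Fin.lt_def, ne_eq, Fin.ext_iff] at *
        omega
      · simp
      · intro c h1 h2
        simp only [Set.mem_ofPred_eq, Fin.lt_def, ne_eq, Fin.ext_iff] at *
        omega
  rw [← key n le_rfl]
  congr 2
  ext u
  simp

/-! ### Regions as slot trees -/

section
variable {n m : ℕ} {Q : Fin n → Fin n → Prop} {C : Set (Fin n → ℝ)}

/-- A connected set crossing a hyperplane meets it, by the intermediate value theorem; conversely,
the segment between two points with equal signs avoids every hyperplane. -/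
theorem connectedComponentIn_eq_iff_sameSideOn
    (hC : ∀ x, x ∈ C ↔ ∀ u j, u ≠ j → ∀ k : ℕ, Sees m Q u j k → x j + k ≠ x u)
    {x y : Fin n → ℝ} (hx : x ∈ C) (hy : y ∈ C) :
    connectedComponentIn C x = connectedComponentIn C y ↔ SameSideOn m Q Finset.univ x y := by
  constructor
  · intro h u _ j _ k hk
    by_cases huj : u = j
    · subst huj
      simp
    have key : ∀ p ∈ connectedComponentIn C x, ∀ q ∈ connectedComponentIn C x,
        p j + k < p u → q j + k < q u := by
      intro p hp q hq hlt
      by_contra hge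
      push Not at hge
      obtain ⟨z, hz, hz0⟩ := isPreconnected_connectedComponentIn.intermediate_value hq hp
        (f := fun z : Fin n → ℝ => z u - z j - k) (by fun_prop)
        (show (0 : ℝ) ∈ _ from ⟨by linarith, by linarith⟩)
      exact (hC z).1 (connectedComponentIn_subset _ _ hz) u j huj k hk (by
        simp only at hz0
        linarith)
    have hxK := mem_connectedComponentIn hx
    have hyK : y ∈ connectedComponentIn C x := h ▸ mem_connectedComponentIn hy
    exact ⟨key x hxK y hyK, key y hyK x hxK⟩
  · intro h
    have hseg : segment ℝ x y ⊆ C := by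
      rintro z ⟨p, q, hp, hq, hpq, rfl⟩
      rw [hC]
      intro u j huj k hk heq
      have hx' := (hC x).1 hx u j huj k hk
      have hy' := (hC y).1 hy u j huj k hk
      have hxy := h u (Finset.mem_univ _) j (Finset.mem_univ _) k hk
      simp only [Pi.add_apply, Pi.smul_apply, smul_eq_mul] at heq
      have hsum : p * (x j + k - x u) + q * (y j + k - y u) = 0 := by
        linear_combination heq + (k : ℝ) * hpq
      rcases lt_or_gt_of_ne hx' with h1 | h1
      · have h2 := hxy.1 h1
        rcases hp.eq_or_lt with rfl | hp'
        · have : q = 1 := by linarith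
          subst this
          linarith
        · nlinarith [mul_pos hp' (sub_pos.2 h1), mul_nonneg hq (sub_pos.2 h2).le]
      · have h2 : y u < y j + k := (not_lt.1 fun h3 => absurd (hxy.2 h3) (not_lt.2 h1.le)).lt_of_ne
          (Ne.symm hy')
        rcases hp.eq_or_lt with rfl | hp'
        · have : q = 1 := by linarith
          subst this
          linarith
        · nlinarith [mul_pos hp' (sub_pos.2 h1), mul_nonneg hq (sub_pos.2 h2).le]
    exact connectedComponentIn_eq ((convex_segment x y).isPreconnected.subset_connectedComponentIn
      (left_mem_segment ℝ x y) hseg (right_mem_segment ℝ x y))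

/-- Regions correspond to slot trees. -/
theorem regions_finite_ncard {A : Set (Set (Fin n → ℝ))} (hQ : m = 0 → ∀ u j, Q u j)
    (hA : ∀ x, x ∈ (⋃₀ A)ᶜ ↔ ∀ u j, u ≠ j → ∀ k : ℕ, Sees m Q u j k → x j + k ≠ x u)
    (P : Fin n → Fin n → Prop) :
    (arrangementRegions A).Finite ∧
      (arrangementRegions A).ncard = (slotMaps m Q P ∅).ncard := by
  have hpt : ∀ t ∈ slotMaps m Q P ∅, ∃ x, GenericOn m Finset.univ x ∧ EncodesOn m t Finset.univ x :=
    fun t ht => exists_encodesOn (fun u v => ht.2.2.1 u v id id) ht.1 ht.2.1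
  choose! pt hgen henc using hpt
  have hgenC : ∀ x, GenericOn m Finset.univ x → x ∈ (⋃₀ A)ᶜ := fun x hx =>
    (hA x).2 fun u j huj k hk =>
      hx j (Finset.mem_univ _) u (Finset.mem_univ _) (Ne.symm huj) k hk.1
  have hcomp : ∀ t ∈ slotMaps m Q P ∅, CompressedOn m Q Finset.univ (pt t) := fun t ht =>
    (henc t ht).compressed (hgen t ht) fun v i h => (ht.2.2.2.1 v i id h).2
  have himage : arrangementRegions A =
      (fun t => connectedComponentIn (⋃₀ A)ᶜ (pt t)) '' slotMaps m Q P ∅ := by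
    ext R
    constructor
    · rintro ⟨x, hx, rfl⟩
      obtain ⟨y, hy, hc, hxy⟩ := exists_compressed hQ Finset.univ x
        fun u _ j _ => (hA x).1 hx u j
      obtain ⟨t, ht⟩ := exists_encodes m y
      have htm : t ∈ slotMaps m Q P ∅ :=
        ⟨ht.wellFounded, fun v i k h => ((ht v (Finset.mem_univ _)).2 i k h).2.1,
          fun u v _ _ h => ht.injective hy h,
          fun u i _ h => ⟨id, ht.rel_of_compressed hc h⟩, fun _ _ h => h.elim⟩
      refine ⟨t, htm, ?_⟩
      have h1 := (connectedComponentIn_eq_iff_sameSideOn hA hx (hgenC y hy)).2 hxy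
      have h2 := (connectedComponentIn_eq_iff_sameSideOn hA (hgenC _ (hgen t htm)) (hgenC y hy)).2
        fun u _ j _ k hk => (henc t htm).sameSide (hgen t htm) hy ht j u k hk.1
      exact h2.trans h1.symm
    · rintro ⟨t, ht, rfl⟩
      exact ⟨_, hgenC _ (hgen t ht), rfl⟩
  refine ⟨himage ▸ finite_slotMaps.image _, ?_⟩
  rw [himage]
  refine Set.InjOn.ncard_image fun t ht t' ht' h => ?_
  have hs := (connectedComponentIn_eq_iff_sameSideOn hA (hgenC _ (hgen t ht))
    (hgenC _ (hgen t' ht'))).1 h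
  refine EncodesOn.unique (hgen t' ht') ((henc t ht).transfer (hgen t ht) fun u v g hg => ?_)
    (henc t' ht')
  exact ⟨(hcomp t ht).lt_of_lt hs.symm v (Finset.mem_univ _) u (Finset.mem_univ _) g hg,
    (hcomp t' ht').lt_of_lt hs v (Finset.mem_univ _) u (Finset.mem_univ _) g hg⟩

end

/-! ### Rooted labelled forests as slot maps -/

section
variable {n : ℕ} {α β : ℤ}

theorem RootedForest.parent_ne_self {V : Type*} (F : RootedForest V) (v : V) :
    F.parent v ≠ some v := by
  intro hv
  obtain ⟨w, hw, hmin⟩ := F.wellFounded.has_min {v} ⟨v, rfl⟩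
  rw [Set.mem_singleton_iff] at hw
  subst hw
  exact hmin _ rfl hv

theorem RootedLabelledForest.one_le_weight (F : RootedLabelledForest n α β)
    (e : F.toRootedForest.Edge) : 1 ≤ F.weight e := by
  rcases lt_trichotomy e.1.1 e.1.2 with h | h | h
  · exact (F.weight_mem_of_lt e h).1
  · exact absurd (h ▸ e.2) (F.parent_ne_self e.1.2)
  · exact (F.weight_mem_of_gt e h).1

/-- The parent of a vertex, together with the weight of the edge to it, diminished by one. -/
def RootedLabelledForest.slots (F : RootedLabelledForest n α β) (v : Fin n) :
    Option (Fin n × ℕ) :=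
  match h : F.parent v with
  | none => none
  | some i => some (i, (F.weight ⟨(i, v), h⟩ - 1).toNat)

theorem RootedLabelledForest.slots_eq_some (F : RootedLabelledForest n α β) (v i : Fin n) (k : ℕ) :
    F.slots v = some (i, k) ↔ ∃ h : F.parent v = some i, F.weight ⟨(i, v), h⟩ = k + 1 := by
  unfold slots
  split
  · rename_i h
    simp [h]
  · rename_i j h
    have h1 := F.one_le_weight ⟨(j, v), h⟩
    simp only [Option.some.injEq, Prod.mk.injEq]
    constructor
    · rintro ⟨rfl, hk⟩
      exact ⟨h, by omega⟩
    · rintro ⟨h', hk⟩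
      obtain rfl : j = i := Option.some.inj (h.symm.trans h')
      exact ⟨rfl, by omega⟩

theorem RootedLabelledForest.slots_injective :
    Function.Injective (RootedLabelledForest.slots (n := n) (α := α) (β := β)) := by
  intro F G h
  have hw : ∀ v i (hF : F.parent v = some i),
      ∃ hG : G.parent v = some i, F.weight ⟨(i, v), hF⟩ = G.weight ⟨(i, v), hG⟩ := by
    intro v i hF
    have h1 := F.one_le_weight ⟨(i, v), hF⟩
    obtain ⟨k, hk⟩ : ∃ k : ℕ, F.weight ⟨(i, v), hF⟩ = k + 1 :=
      ⟨(F.weight ⟨(i, v), hF⟩ - 1).toNat, by omega⟩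
    obtain ⟨hG, hG'⟩ := (G.slots_eq_some v i k).1 (h ▸ (F.slots_eq_some v i k).2 ⟨hF, hk⟩)
    exact ⟨hG, hk.trans hG'.symm⟩
  have hp : F.parent = G.parent := by
    funext v
    cases hF : F.parent v with
    | some i => exact (hw v i hF).1.symm
    | none =>
      cases hG : G.parent v with
      | none => rfl
      | some i =>
        have h1 := G.one_le_weight ⟨(i, v), hG⟩
        have h2 := (G.slots_eq_some v i (G.weight ⟨(i, v), hG⟩ - 1).toNat).2 ⟨hG, by omega⟩
        rw [← h, F.slots_eq_some] at h2
        exact absurd (hF.symm.trans h2.1) (by simp)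
  obtain ⟨⟨p, wf⟩, w, w1, w2⟩ := F
  obtain ⟨⟨p', wf'⟩, w', w1', w2'⟩ := G
  simp only at hp
  subst hp
  have : w = w' := by
    funext ⟨⟨i, v⟩, he⟩
    exact (hw v i he).2
  subst this
  rfl

/-- With `U` everything, only the bound on slots and `P` in slot `m` remain. Descending edges stop
at weight `m`, that is slot `m - 1`, so slot `m` is left to ascending edges. -/
theorem RootedLabelledForest.range_slots {m : ℕ} {Q P : Fin n → Fin n → Prop}
    (hP : ∀ v i, P v i → i < v) (hβ : β = m)
    (hα : ∀ v i, i < v → ∀ k : ℕ, (k : ℤ) + 1 ≤ α ↔ k ≤ m ∧ (k = m → P v i)) :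
    Set.range (RootedLabelledForest.slots (n := n) (α := α) (β := β)) =
      slotMaps m Q P Set.univ := by
  ext g
  constructor
  · rintro ⟨F, rfl⟩
    have key : ∀ v i k, F.slots v = some (i, k) → k ≤ m ∧ (k = m → P v i) := by
      intro v i k hk
      obtain ⟨h, hw⟩ := (F.slots_eq_some v i k).1 hk
      rcases lt_trichotomy i v with hlt | rfl | hlt
      · exact (hα v i hlt k).1 (hw ▸ (F.weight_mem_of_lt ⟨(i, v), h⟩ hlt).2)
      · exact absurd h (F.parent_ne_self i)
      · have h1 := (F.weight_mem_of_gt ⟨(i, v), h⟩ hlt).2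
        rw [hw, hβ] at h1
        exact ⟨by omega, fun h => by omega⟩
    refine ⟨?_, fun v i k h => (key v i k h).1, fun u _ h => absurd trivial h,
      fun u _ h => absurd trivial h, fun v i _ h => (key v i m h).2 rfl⟩
    refine Subrelation.wf ?_ F.wellFounded
    rintro i j ⟨k, hk⟩
    exact ((F.slots_eq_some j i k).1 hk).1
  · rintro ⟨hwf, hm, -, -, hp⟩
    have hsome : ∀ v i, (g v).map Prod.fst = some i → ∃ k, g v = some (i, k) := by
      intro v i h
      obtain ⟨⟨j, k⟩, h1, rfl⟩ := Option.map_eq_some_iff.1 h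
      exact ⟨k, h1⟩
    let F : RootedLabelledForest n α β :=
      { parent := fun v => (g v).map Prod.fst
        wellFounded := Subrelation.wf (fun {i j} h => hsome j i h) hwf
        weight := fun e => (((g e.1.2).elim 0 Prod.snd : ℕ) : ℤ) + 1
        weight_mem_of_lt := by
          rintro ⟨⟨i, v⟩, h⟩ hlt
          obtain ⟨k, hk⟩ := hsome v i h
          simp only [hk, Option.elim_some]
          refine ⟨by omega, (hα v i hlt k).2 ⟨hm _ _ _ hk, ?_⟩⟩
          rintro rfl
          exact hp v i trivial hk
        weight_mem_of_gt := by
          rintro ⟨⟨i, v⟩, h⟩ hlt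
          obtain ⟨k, hk⟩ := hsome v i h
          simp only [hk, Option.elim_some]
          have h1 := hm _ _ _ hk
          have h2 : k ≠ m := by
            rintro rfl
            exact absurd (hP v i (hp v i trivial hk)) (not_lt.2 (le_of_lt hlt))
          exact ⟨by omega, by omega⟩ }
    refine ⟨F, funext fun v => Option.ext fun q => ?_⟩
    obtain ⟨i, k⟩ := q
    simp only [F.slots_eq_some]
    constructor
    · rintro ⟨h, hw⟩
      obtain ⟨k', hk'⟩ := hsome v i h
      have hw' : (((g v).elim 0 Prod.snd : ℕ) : ℤ) + 1 = k + 1 := hw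
      rw [hk', Option.elim_some] at hw'
      have : k' = k := by
        simp only at hw'
        omega
      rw [hk', this]
    · intro h
      refine ⟨show (g v).map Prod.fst = some i by rw [h]; rfl, ?_⟩
      show (((g v).elim 0 Prod.snd : ℕ) : ℤ) + 1 = k + 1
      rw [h]
      rfl

theorem RootedLabelledForest.finite_card {m : ℕ} (Q : Fin n → Fin n → Prop)
    {P : Fin n → Fin n → Prop} (hP : ∀ v i, P v i → i < v) (hβ : β = m)
    (hα : ∀ v i, i < v → ∀ k : ℕ, (k : ℤ) + 1 ≤ α ↔ k ≤ m ∧ (k = m → P v i)) :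
    Finite (RootedLabelledForest n α β) ∧
      Nat.card (RootedLabelledForest n α β) = (slotMaps m Q P Set.univ).ncard := by
  have hr := range_slots (Q := Q) hP hβ hα
  refine ⟨?_, ?_⟩
  · have : Finite (Set.range (slots (n := n) (α := α) (β := β))) := by
      rw [hr]
      exact finite_slotMaps.to_subtype
    exact Finite.of_injective_finite_range slots_injective
  · rw [← hr, ← Nat.card_coe_set_eq]
    exact (Nat.card_range_of_injective slots_injective).symm

end

/-! ### The interval gain graph and the conclusion -/

/-- Gains `g ≥ 0` and `g ≤ 0` are read as offsets `k = |g|` in the two orientations: up to `b` from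
the smaller vertex, up to `-a` from the larger. -/
theorem mem_compl_arrangement {n m : ℕ} {a b : ℤ} {Q : Fin n → Fin n → Prop} (hb : b = m)
    (ha : a ≤ 0 ∧ -a ≤ m)
    (hQ : ∀ j u, j < u → Q u j) (hQ' : ∀ j u, u < j → ∀ k : ℕ, Sees m Q u j k ↔ (k : ℤ) ≤ -a)
    (x : Fin n → ℝ) :
    x ∈ (⋃₀ (intervalGainGraph n a b).arrangement)ᶜ ↔
      ∀ u j, u ≠ j → ∀ k : ℕ, Sees m Q u j k → x j + k ≠ x u := by
  constructor
  · intro h u j huj k hk heq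
    apply h
    rcases lt_or_gt_of_ne huj with hlt | hlt
    · have h1 := (hQ' j u hlt k).1 hk
      refine ⟨_, ⟨u, j, -(k : ℤ), hlt, Or.inl ⟨hlt, by constructor <;> omega⟩, rfl⟩, ?_⟩
      show x j - x u = ((-(k : ℤ) : ℤ) : ℝ)
      push_cast
      linarith
    · have h1 := hk.1
      refine ⟨_, ⟨j, u, (k : ℤ), hlt, Or.inl ⟨hlt, by constructor <;> omega⟩, rfl⟩, ?_⟩
      show x u - x j = ((k : ℤ) : ℝ)
      push_cast
      linarith
  · rintro h ⟨H, ⟨i, j, g, hij, hg | hg, rfl⟩, hx⟩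
    · have hx : x j - x i = (g : ℝ) := hx
      obtain ⟨-, h1, h2⟩ := hg
      rcases le_total 0 g with h0 | h0
      · obtain ⟨k, rfl⟩ := Int.eq_ofNat_of_zero_le h0
        refine h j i hij.ne' k ⟨by omega, fun _ => hQ i j hij⟩ ?_
        push_cast at hx
        linarith
      · obtain ⟨k, hk⟩ := Int.eq_ofNat_of_zero_le (neg_nonneg.2 h0)
        obtain rfl : g = -(k : ℤ) := by omega
        refine h i j hij.ne k ((hQ' j i hij k).2 (by omega)) ?_
        push_cast at hx
        linarith
    · exact absurd hg.1 hij.not_gt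

theorem mainTheorem6 (n : ℕ) (hn : 1 ≤ n) (a b : ℤ) (hab : a ≤ b) (h : a + b = 0 ∨ a + b = 1) :
    (arrangementRegions (intervalGainGraph n a b).arrangement).Finite ∧
      Finite (RootedLabelledForest n (1 - a) b) ∧
      (arrangementRegions (intervalGainGraph n a b).arrangement).ncard =
        Nat.card (RootedLabelledForest n (1 - a) b) := by
  obtain ⟨m, rfl⟩ := Int.eq_ofNat_of_zero_le (show 0 ≤ b by omega)
  have ha : a ≤ 0 ∧ -a ≤ m := by omega
  rcases h with h | h
  · have hk : ∀ k : ℕ, k ≤ m ↔ (k : ℤ) ≤ -a := by omega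
    have hk' : ∀ k : ℕ, (k : ℤ) + 1 ≤ 1 - a ↔ k ≤ m := by omega
    obtain ⟨h1, h2⟩ := regions_finite_ncard (m := m) (Q := fun _ _ => True) (fun _ _ _ => trivial)
      (mem_compl_arrangement (a := a) (b := m) rfl ha (fun _ _ _ => trivial)
        fun j u _ k => Iff.trans ⟨fun h => h.1, fun h => ⟨h, fun _ => trivial⟩⟩ (hk k)) (fun v i : Fin n => i < v)
    obtain ⟨h3, h4⟩ := RootedLabelledForest.finite_card (n := n) (α := 1 - a) (β := m) (m := m)
      (fun _ _ => True) (P := fun v i : Fin n => i < v) (fun _ _ h => h) rfl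
      fun v i hlt k => (hk' k).trans ⟨fun h => ⟨h, fun _ => hlt⟩, fun h => h.1⟩
    exact ⟨h1, h3, h2.trans ((ncard_slotMaps_catalan n m).symm.trans h4.symm)⟩
  -- With `a = 1 - m`, the bound `a ≤ b` excludes `m = 0`, so offset `0` is recorded for every pair.
  · have hm : m ≠ 0 := by omega
    have hk : ∀ k : ℕ, k ≤ m ∧ ¬ k = m ↔ (k : ℤ) ≤ -a := by omega
    have hk' : ∀ k : ℕ, (k : ℤ) + 1 ≤ 1 - a ↔ k ≤ m ∧ ¬ k = m := by omega
    obtain ⟨h1, h2⟩ := regions_finite_ncard (m := m) (Q := fun v i : Fin n => i < v) (fun h0 => absurd h0 hm)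
      (mem_compl_arrangement (a := a) (b := m) rfl ha (fun _ _ h => h)
        fun j u hlt k => Iff.trans ⟨fun h => ⟨h.1, fun h0 => hlt.not_gt (h.2 h0)⟩,
          fun h => ⟨h.1, fun h0 => absurd h0 h.2⟩⟩ (hk k)) (fun _ _ => False)
    obtain ⟨h3, h4⟩ := RootedLabelledForest.finite_card (n := n) (α := 1 - a) (β := m) (m := m)
      (fun v i : Fin n => i < v) (P := fun _ _ => False) (fun _ _ h => h.elim) rfl
      fun v i hlt k => hk' k
    exact ⟨h1, h3, h2.trans ((ncard_slotMaps_shi n m).symm.trans h4.symm)⟩
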